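/- All Hilbert spaces are finite-dimensional and input spaces are non-zero; a channel is a completely positive trace-preserving linear map, and a state is a positive operator of trace at most $1$. Let $$\Lambda:\mathcal L\Big(\bigotimes_{k=1}^N\mathcal H^{k}_{in}\Big)\to\mathcal L\Big(\bigotimes_{k=1}^N\mathcal H^{k}_{out}\Big)$$ be an $N$-partite channel with parties $A_1,\dots,A_N$. For a bipartition $S_A\sqcup S_B=\{1,\dots,N\}$ write $S_B\not\to S_A$ (semicausality from $S_B$ to $S_A$) if there is a channel $\Gamma:\mathcal L(\mathcal H^{S_A}_{in})\to\mathcal L(\mathcal H^{S_A}_{out})$ with $\mathrm{tr}_{S_B}\{\Lambda[\rho]\}=\Gamma(\mathrm{tr}_{S_B}[\rho])$ for all states $\rho$ on $\bigotimes_k\mathcal H^k_{in}$. Assume $A_N\not\to\cdots\not\to A_2\not\to A_1$, that is, $\{k+1,\dots,N\}\not\to\{1,\dots,k\}$ for every $1\le k<N$. Then there exist finite-dimensional Hilbert spaces $\mathcal H^E_0,\mathcal H^E_1,\dots,\mathcal H^E_N$ (the initial, intermediate and final spaces of an ancilla $E$), a unit vector $|0\rangle\in\mathcal H^E_0$, and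 unitary operators $$U_{A_kE}:\mathcal H^{k}_{in}\otimes\mathcal H^{E}_{k-1}\to\mathcal H^{k}_{out}\otimes\mathcal H^{E}_{k}\qquad(1\le k\le N)$$ such that, for every operator $\rho$ on $\bigotimes_k\mathcal H^k_{in}$ (in particular for every state), $$\Lambda[\rho]=\mathrm{tr}_E\big\{U\,(\rho\otimes|0\rangle\langle 0|_E)\,U^\dagger\big\},\qquad U=U_{A_NE}\cdots U_{A_2E}\,U_{A_1E},$$ where each factor $U_{A_kE}$ acts as the identity on all parties other than $A_k$, and $\mathrm{tr}_E$ is the partial trace over $\mathcal H^E_N$. -/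

import Mathlib

open scoped Kronecker ComplexOrder

/-! A finite-dimensional Hilbert space with a fixed orthonormal basis labelled by a finite type `a`
is written through its label type: operators are complex matrices indexed by `a`, and the
(tensor) product of the spaces labelled by `m i` has its basis labelled by `∀ i, m i`. -/

/-- A (possibly subnormalised) state: a positive operator with trace at most `1`. -/
def IsState {a : Type*} [Fintype a] (ρ : Matrix a a ℂ) : Prop :=
  ρ.PosSemidef ∧ ρ.trace ≤ 1

/-- The amplification `id ⊗ Φ` on `L(ℂʳ ⊗ H)`. -/
def amplify {a b : Type*} (Φ : Matrix a a ℂ →ₗ[ℂ] Matrix b b ℂ) (r : ℕ)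
    (X : Matrix (Fin r × a) (Fin r × a) ℂ) : Matrix (Fin r × b) (Fin r × b) ℂ :=
  Matrix.of fun p q => Φ (Matrix.of fun x y => X (p.1, x) (q.1, y)) p.2 q.2

/-- Complete positivity: every amplification preserves positive semidefiniteness. -/
def IsCompletelyPositive {a b : Type*} [Fintype a] [Fintype b]
    (Φ : Matrix a a ℂ →ₗ[ℂ] Matrix b b ℂ) : Prop :=
  ∀ (r : ℕ) (X : Matrix (Fin r × a) (Fin r × a) ℂ), X.PosSemidef → (amplify Φ r X).PosSemidef

/-- A quantum channel: a completely positive trace-preserving linear map. -/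
def IsChannel {a b : Type*} [Fintype a] [Fintype b]
    (Φ : Matrix a a ℂ →ₗ[ℂ] Matrix b b ℂ) : Prop :=
  IsCompletelyPositive Φ ∧ ∀ X : Matrix a a ℂ, (Φ X).trace = X.trace

/-- The reduced operator on the parties in `S`: the partial trace over all parties outside `S`. -/
def reduce {ι : Type*} [Fintype ι] [DecidableEq ι] {m : ι → Type*} [∀ i, Fintype (m i)]
    (S : Finset ι) (X : Matrix (∀ i, m i) (∀ i, m i) ℂ) :
    Matrix (∀ i : {i // i ∈ S}, m i) (∀ i : {i // i ∈ S}, m i) ℂ :=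
  Matrix.of fun x y => ∑ z : (∀ i : {i // ¬ i ∈ S}, m i),
    X ((Equiv.piEquivPiSubtypeProd (· ∈ S) m).symm (x, z))
      ((Equiv.piEquivPiSubtypeProd (· ∈ S) m).symm (y, z))

/-- `Sᶜ ↛ S`: the reduced output state of the parties in `S` is obtained by a channel from the
reduced input state of the parties in `S`. -/
def IsSemicausal {ι : Type*} [Fintype ι] [DecidableEq ι] {m n : ι → Type*}
    [∀ i, Fintype (m i)] [∀ i, Fintype (n i)]
    (Φ : Matrix (∀ i, m i) (∀ i, m i) ℂ →ₗ[ℂ] Matrix (∀ i, n i) (∀ i, n i) ℂ)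
    (S : Finset ι) : Prop :=
  ∃ Γ : Matrix (∀ i : {i // i ∈ S}, m i) (∀ i : {i // i ∈ S}, m i) ℂ →ₗ[ℂ]
      Matrix (∀ i : {i // i ∈ S}, n i) (∀ i : {i // i ∈ S}, n i) ℂ,
    IsChannel Γ ∧ ∀ ρ, IsState ρ → reduce S (Φ ρ) = Γ (reduce S ρ)

/-- `A_N ↛ … ↛ A_2 ↛ A_1`: for every cut `1 ≤ k < N` the last `N - k` parties do not signal to the
first `k` parties. -/
def IsOrderedSemicausal {N : ℕ} {m n : Fin N → Type*}
    [∀ k, Fintype (m k)] [∀ k, Fintype (n k)]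
    (Φ : Matrix (∀ k, m k) (∀ k, m k) ℂ →ₗ[ℂ] Matrix (∀ k, n k) (∀ k, n k) ℂ) : Prop :=
  ∀ k : ℕ, 1 ≤ k → k < N →
    IsSemicausal Φ (Finset.univ.filter fun i : Fin N => (i : ℕ) < k)

/-- A unitary operator between (a priori different) spaces. -/
def IsUnitaryOp {a b : Type*} [Fintype a] [DecidableEq a] [Fintype b] [DecidableEq b]
    (U : Matrix b a ℂ) : Prop :=
  U.conjTranspose * U = 1 ∧ U * U.conjTranspose = 1

/-- The sequential composition `U_{A_N E} ⋯ U_{A_2 E} U_{A_1 E}`, where the ancilla `E` has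
dimension `e k` after the first `k` factors and each factor acts as the identity on all parties
but its own. The parties are numbered from `0`, and party `k` has factor `U k`. In the recursive
step the product of the first `N` factors is tensored with the identity on the input of the last
party, and is followed by the factor of the last party tensored with the identity on the outputs
of the others. -/
noncomputable def sequentialOp : (N : ℕ) → (m : Fin N → Type*) → (n : Fin N → Type*) →
    [∀ k, Fintype (m k)] → [∀ k, DecidableEq (m k)] →
    [∀ k, Fintype (n k)] → [∀ k, DecidableEq (n k)] → (e : ℕ → ℕ) →
    (∀ k : Fin N, Matrix (n k × Fin (e (k + 1))) (m k × Fin (e k)) ℂ) →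
    Matrix ((∀ k, n k) × Fin (e N)) ((∀ k, m k) × Fin (e 0)) ℂ
  | 0, _, _, _, _, _, _, _, _ => (1 : Matrix _ _ ℂ).submatrix Prod.snd Prod.snd
  | N + 1, m, n, _, _, _, _, e, U =>
    let W : Matrix ((∀ k : Fin N, n k.castSucc) × Fin (e N))
        ((∀ k : Fin N, m k.castSucc) × Fin (e 0)) ℂ :=
      sequentialOp N (fun k => m k.castSucc) (fun k => n k.castSucc) e fun k => U k.castSucc
    let first : Matrix ((∀ k : Fin N, n k.castSucc) × (m (Fin.last N) × Fin (e N)))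
        ((∀ k, m k) × Fin (e 0)) ℂ :=
      (W ⊗ₖ (1 : Matrix (m (Fin.last N)) (m (Fin.last N)) ℂ)).submatrix
        (fun p => ((p.1, p.2.2), p.2.1)) (fun q => ((Fin.init q.1, q.2), q.1 (Fin.last N)))
    let last : Matrix ((∀ k, n k) × Fin (e (N + 1)))
        ((∀ k : Fin N, n k.castSucc) × (m (Fin.last N) × Fin (e N))) ℂ :=
      ((1 : Matrix (∀ k : Fin N, n k.castSucc) (∀ k : Fin N, n k.castSucc) ℂ) ⊗ₖ
          U (Fin.last N)).submatrix
        (fun p => (Fin.init p.1, (p.1 (Fin.last N), p.2))) id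
    last * first

/-- The partial trace `tr_E` over the second tensor factor. -/
def traceAncilla {a c : Type*} [Fintype c] (X : Matrix (a × c) (a × c) ℂ) : Matrix a a ℂ :=
  Matrix.of fun x y => ∑ f, X (x, f) (y, f)

/-- The rank-one projector `|ψ⟩⟨ψ|`. -/
def ketbra {c : Type*} (ψ : EuclideanSpace ℂ c) : Matrix c c ℂ :=
  Matrix.vecMulVec (fun i => ψ i) (fun i => star (ψ i))

/-! Two Stinespring dilations of one map with ancillas of equal dimension differ by a unitary on the
ancilla. Semicausality with respect to the last party says `tr_N ∘ Λ = Γ ∘ tr_N`, where `Γ` is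
again semicausal in the remaining parties. This map has two dilations: one is a dilation `V` of
`Λ` with the output of the last party counted as ancilla, the other is `W ⊗ 1`, where `W` dilates
`Γ` and the untouched input of the last party is counted as ancilla. Hence `V = (1 ⊗ U) (W ⊗ 1)`
with a unitary `U` of the last party and the ancilla, and induction on the number of parties factors
`W`. The ancilla dimensions are chosen beforehand, so large that the dilations exist and in such
proportions that every `U` is square. -/

open Matrix

section Isometry

open Module

variable {𝕜 E F F' : Type*}

theorem exists_linearIsometry_range_apply_eq [Ring 𝕜] [AddCommGroup E] [Module 𝕜 E]
    [SeminormedAddCommGroup F] [Module 𝕜 F] [NormedAddCommGroup F'] [Module 𝕜 F']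
    (f : E →ₗ[𝕜] F) (g : E →ₗ[𝕜] F')
    (hnorm : ∀ v, ‖g v‖ = ‖f v‖) :
    ∃ G : LinearMap.range f →ₗᵢ[𝕜] F', ∀ v, G ⟨f v, LinearMap.mem_range_self f v⟩ = g v := by
  have hker : LinearMap.ker f ≤ LinearMap.ker g := fun v hv => by
    rw [LinearMap.mem_ker] at hv ⊢
    rw [← norm_eq_zero, hnorm, hv, norm_zero]
  let h : LinearMap.range f →ₗ[𝕜] F' :=
    (LinearMap.ker f).liftQ g hker ∘ₗ f.quotKerEquivRange.symm.toLinearMap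
  have hh : ∀ v, h ⟨f v, LinearMap.mem_range_self f v⟩ = g v := fun v => by
    simp only [h, LinearMap.comp_apply, LinearEquiv.coe_coe]
    rw [LinearMap.quotKerEquivRange_symm_apply_image f v, Submodule.mkQ_apply,
      Submodule.liftQ_apply]
  refine ⟨⟨h, ?_⟩, hh⟩
  rintro ⟨_, v, rfl⟩
  rw [hh, hnorm, Submodule.coe_norm]

theorem exists_linearIsometryEquiv_apply_eq [RCLike 𝕜] [AddCommGroup E] [Module 𝕜 E]
    [NormedAddCommGroup F] [InnerProductSpace 𝕜 F] [FiniteDimensional 𝕜 F]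
    [NormedAddCommGroup F'] [InnerProductSpace 𝕜 F'] [FiniteDimensional 𝕜 F']
    (f : E →ₗ[𝕜] F) (g : E →ₗ[𝕜] F')
    (hnorm : ∀ v, ‖g v‖ = ‖f v‖) (hrank : finrank 𝕜 F = finrank 𝕜 F') :
    ∃ T : F ≃ₗᵢ[𝕜] F', ∀ v, T (f v) = g v := by
  obtain ⟨G, hG⟩ := exists_linearIsometry_range_apply_eq f g hnorm
  let σ : F' ≃ₗᵢ[𝕜] F :=
    (stdOrthonormalBasis 𝕜 F').equiv (stdOrthonormalBasis 𝕜 F) (finCongr hrank.symm)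
  let T : F →ₗᵢ[𝕜] F := (σ.toLinearIsometry.comp G).extend
  refine ⟨(T.toLinearIsometryEquiv rfl).trans σ.symm, fun v => ?_⟩
  have hT : T (f v) = σ (g v) := by
    rw [← hG v]
    exact LinearIsometry.extend_apply _ (⟨f v, LinearMap.mem_range_self f v⟩ : LinearMap.range f)
  simp [hT]

end Isometry

section Unitary

variable {k k' l : Type*} [Fintype k]

theorem norm_toEuclideanLin_sq [Fintype l] [DecidableEq l] (X : Matrix k l ℂ)
    (v : EuclideanSpace ℂ l) :
    (‖X.toEuclideanLin v‖ : ℂ) ^ 2 = inner ℂ v ((Xᴴ * X).toEuclideanLin v) := by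
  classical
  rw [toLpLin_mul_same, LinearMap.comp_apply, toEuclideanLin_conjTranspose_eq_adjoint,
    LinearMap.adjoint_inner_right, inner_self_eq_norm_sq_to_K]
  rfl

theorem exists_isUnitaryOp_mul_eq [DecidableEq k] [Fintype k'] [DecidableEq k'] [Finite l]
    (X : Matrix k l ℂ) (Y : Matrix k' l ℂ) (hcard : Fintype.card k = Fintype.card k')
    (hgram : Xᴴ * X = Yᴴ * Y) : ∃ Q : Matrix k' k ℂ, IsUnitaryOp Q ∧ Q * X = Y := by
  classical
  cases nonempty_fintype l
  have hnorm (v) : ‖Y.toEuclideanLin v‖ = ‖X.toEuclideanLin v‖ := by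
    rw [← sq_eq_sq₀ (norm_nonneg _) (norm_nonneg _)]
    exact_mod_cast (norm_toEuclideanLin_sq Y v).trans
      (hgram ▸ (norm_toEuclideanLin_sq X v).symm)
  obtain ⟨T, hT⟩ := exists_linearIsometryEquiv_apply_eq _ _ hnorm (by simpa using hcard)
  obtain ⟨Q, hQ⟩ := (toEuclideanLin (𝕜 := ℂ)).surjective T.toLinearEquiv.toLinearMap
  have hisom : Qᴴ * Q = 1 := by
    apply (toEuclideanLin (𝕜 := ℂ)).injective
    refine LinearMap.ext fun v => ext_inner_left ℂ fun w => ?_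
    rw [toLpLin_mul_same, LinearMap.comp_apply, toEuclideanLin_conjTranspose_eq_adjoint,
      LinearMap.adjoint_inner_right, hQ, toLpLin_one]
    exact T.inner_map_map w v
  refine ⟨Q, ⟨hisom, (mul_eq_one_comm_of_card_eq k k' ℂ hcard).mp hisom⟩, ?_⟩
  apply (toEuclideanLin (𝕜 := ℂ)).injective
  rw [toLpLin_mul_same, hQ]
  exact LinearMap.ext hT

end Unitary

open scoped MatrixOrder Matrix.Norms.L2Operator in
theorem span_posSemidef (a : Type*) [Finite a] :
    Submodule.span ℂ {ρ : Matrix a a ℂ | ρ.PosSemidef} = ⊤ := by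
  classical
  cases nonempty_fintype a
  simpa only [nonneg_iff_posSemidef] using CStarAlgebra.span_nonneg (A := Matrix a a ℂ)

open scoped MatrixOrder Matrix.Norms.L2Operator in
theorem exists_eq_conjTranspose_mul_self {a : Type*} [Fintype a] {A : Matrix a a ℂ}
    (hA : A.PosSemidef) : ∃ B : Matrix a a ℂ, A = Bᴴ * B := by
  classical
  exact CStarAlgebra.nonneg_iff_eq_star_mul_self.mp hA.nonneg

theorem exists_isState_smul {a : Type*} [Fintype a] {ρ : Matrix a a ℂ} (hρ : ρ.PosSemidef) :
    ∃ c : ℂ, c ≠ 0 ∧ IsState (c • ρ) := by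
  obtain ⟨t, ht, htr⟩ : ∃ t : ℝ, 0 ≤ t ∧ (t : ℂ) = ρ.trace :=
    RCLike.nonneg_iff_exists_ofReal.mp hρ.trace_nonneg
  have hpos : 0 < 1 + t := by positivity
  refine ⟨((1 + t)⁻¹ : ℝ), by exact_mod_cast (inv_pos.mpr hpos).ne',
    hρ.smul (by exact_mod_cast (inv_pos.mpr hpos).le), ?_⟩
  rw [trace_smul, ← htr, smul_eq_mul]
  have hle : (1 + t)⁻¹ * t ≤ 1 := (inv_mul_le_iff₀ hpos).mpr (by linarith)
  exact_mod_cast hle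

theorem linearMap_ext_isState {a V : Type*} [Fintype a] [AddCommGroup V] [Module ℂ V]
    {f g : Matrix a a ℂ →ₗ[ℂ] V} (h : ∀ ρ, IsState ρ → f ρ = g ρ) : f = g := by
  refine LinearMap.ext_on (span_posSemidef a) fun ρ hρ => ?_
  obtain ⟨c, hc, hstate⟩ := exists_isState_smul hρ
  have hsmul := h _ hstate
  rw [map_smul, map_smul] at hsmul
  exact smul_right_injective V hc hsmul

section Dilation

variable {a b c c' d : Type*} [Fintype a] [Fintype c] [Fintype c']

/-- `V` is a dilation of `Φ` with ancilla `c`, that is, `Φ X = tr_c (V X V†)`. No isometry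
condition is imposed: it is automatic when `Φ` preserves the trace. -/
def IsDilation (Φ : Matrix a a ℂ →ₗ[ℂ] Matrix b b ℂ) (V : Matrix (b × c) a ℂ) : Prop :=
  ∀ X, Φ X = traceAncilla (V * X * Vᴴ)

/-- The map `X ↦ J X J†` on operators. -/
def conjMap (J : Matrix d a ℂ) : Matrix a a ℂ →ₗ[ℂ] Matrix d d ℂ where
  toFun X := J * X * Jᴴ
  map_add' X Y := by rw [Matrix.mul_add, Matrix.add_mul]
  map_smul' r X := by rw [Matrix.mul_smul, Matrix.smul_mul, RingHom.id_apply]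

theorem conjMap_apply (J : Matrix d a ℂ) (X : Matrix a a ℂ) : conjMap J X = J * X * Jᴴ := rfl

theorem IsDilation.comp_conjMap [Fintype d] {Φ : Matrix d d ℂ →ₗ[ℂ] Matrix b b ℂ}
    {V : Matrix (b × c) d ℂ} (h : IsDilation Φ V) (J : Matrix d a ℂ) :
    IsDilation (Φ ∘ₗ conjMap J) (V * J) := fun X => by
  rw [LinearMap.comp_apply, conjMap_apply, h, conjTranspose_mul]
  simp only [Matrix.mul_assoc]

theorem isDilation_iff [DecidableEq a] {Φ : Matrix a a ℂ →ₗ[ℂ] Matrix b b ℂ}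
    {V : Matrix (b × c) a ℂ} :
    IsDilation Φ V ↔
      ∀ i j x y, Φ (single i j 1) x y = ∑ f, V (x, f) i * star (V (y, f) j) := by
  have hsingle (i j x y) : traceAncilla (V * single i j (1 : ℂ) * Vᴴ) x y =
      ∑ f, V (x, f) i * star (V (y, f) j) := by
    simp [traceAncilla, Matrix.mul_apply, single_apply, ite_and]
  refine ⟨fun h i j x y => (congrFun₂ (h _) x y).trans (hsingle i j x y), fun h X => ?_⟩
  induction X using Matrix.induction_on' with
  | h_zero => ext; simp [traceAncilla]
  | h_add X Y hX hY =>
    ext x y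
    simp [hX, hY, traceAncilla, Matrix.mul_add, Matrix.add_mul, Finset.sum_add_distrib]
  | h_std_basis i j r =>
    ext x y
    rw [← mul_one r, ← smul_eq_mul, ← smul_single, map_smul, Matrix.smul_apply, h, ← hsingle]
    simp only [traceAncilla, of_apply, Matrix.mul_smul, Matrix.smul_mul, Matrix.smul_apply,
      Finset.smul_sum]

theorem IsDilation.exists_of_card_le {Φ : Matrix a a ℂ →ₗ[ℂ] Matrix b b ℂ}
    {V : Matrix (b × c) a ℂ} (h : IsDilation Φ V) (hcard : Fintype.card c ≤ Fintype.card c') :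
    ∃ V' : Matrix (b × c') a ℂ, IsDilation Φ V' := by
  classical
  obtain ⟨s⟩ := Function.Embedding.nonempty_of_card_le hcard
  refine ⟨of fun p i => Function.extend s (fun f => V (p.1, f) i) 0 p.2,
    isDilation_iff.mpr fun i j x y => ?_⟩
  rw [isDilation_iff.mp h]
  refine Fintype.sum_of_injective s s.injective _ _ (fun f hf => ?_) fun f => ?_
  · simp [Function.extend_apply' _ _ _ hf]
  · simp [s.injective.extend_apply]

theorem IsDilation.exists_isUnitaryOp [Fintype b] [DecidableEq b] [DecidableEq c] [DecidableEq c']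
    {Φ : Matrix a a ℂ →ₗ[ℂ] Matrix b b ℂ} {V : Matrix (b × c) a ℂ} {W : Matrix (b × c') a ℂ}
    (hV : IsDilation Φ V) (hW : IsDilation Φ W) (hcard : Fintype.card c = Fintype.card c') :
    ∃ Q : Matrix c' c ℂ, IsUnitaryOp Q ∧ W = ((1 : Matrix b b ℂ) ⊗ₖ Q) * V := by
  classical
  let V' : Matrix c (b × a) ℂ := of fun f p => V (p.1, f) p.2
  let W' : Matrix c' (b × a) ℂ := of fun f p => W (p.1, f) p.2
  have hgram : V'ᴴ * V' = W'ᴴ * W' := by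
    ext ⟨y, j⟩ ⟨x, i⟩
    have h := (isDilation_iff.mp hV i j x y).symm.trans (isDilation_iff.mp hW i j x y)
    simpa only [Matrix.mul_apply, conjTranspose_apply, V', W', of_apply, mul_comm] using h
  obtain ⟨Q, hQ, hmul⟩ := exists_isUnitaryOp_mul_eq V' W' hcard hgram
  refine ⟨Q, hQ, ?_⟩
  ext ⟨x, f⟩ i
  have h := congrFun (congrFun hmul f) (x, i)
  simpa [Matrix.mul_apply, Fintype.sum_prod_type, one_apply, V', W'] using h.symm

/-- The unnormalised maximally entangled vector `∑ i, |i⟩|i⟩`, the first factor indexed by `Fin`. -/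
noncomputable def maxEntangled (a : Type*) [Fintype a] : Fin (Fintype.card a) × a → ℂ :=
  open Classical in fun p => if (Fintype.equivFin a).symm p.1 = p.2 then 1 else 0

theorem amplify_maxEntangled [DecidableEq a] (Φ : Matrix a a ℂ →ₗ[ℂ] Matrix b b ℂ) (i j : a)
    (x y : b) :
    amplify Φ (Fintype.card a) (vecMulVec (maxEntangled a) (star (maxEntangled a)))
      (Fintype.equivFin a i, x) (Fintype.equivFin a j, y) = Φ (single i j 1) x y := by
  refine congrArg (fun Y => Φ Y x y) ?_
  ext p q
  by_cases hp : i = p <;> by_cases hq : j = q <;>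
    simp [maxEntangled, vecMulVec_apply, hp, hq]

theorem IsCompletelyPositive.exists_isDilation [Fintype b] {Φ : Matrix a a ℂ →ₗ[ℂ] Matrix b b ℂ}
    (h : IsCompletelyPositive Φ) :
    ∃ V : Matrix (b × (Fin (Fintype.card a) × b)) a ℂ, IsDilation Φ V := by
  classical
  -- A row of the factor `B` of the Choi matrix is, up to conjugation, a Kraus operator of `Φ`.
  obtain ⟨B, hB⟩ := exists_eq_conjTranspose_mul_self
    (h _ _ (posSemidef_vecMulVec_self_star (maxEntangled a)))
  refine ⟨of fun p i => star (B p.2 (Fintype.equivFin a i, p.1)),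
    isDilation_iff.mpr fun i j x y => ?_⟩
  rw [← amplify_maxEntangled, hB]
  simp [Matrix.mul_apply]

end Dilation

section Reduce

variable {ι : Type*} [Fintype ι] [DecidableEq ι] {m n : ι → Type*} [∀ i, Fintype (m i)]
  [∀ i, Fintype (n i)]

/-- The parties outside `S` do not signal to those in `S`: the reduced output of `Φ` on `S`
depends on the reduced input on `S` only. -/
def IsNonsignalling (Φ : Matrix (∀ i, m i) (∀ i, m i) ℂ →ₗ[ℂ] Matrix (∀ i, n i) (∀ i, n i) ℂ)
    (S : Finset ι) : Prop :=
  ∀ X, reduce S X = 0 → reduce S (Φ X) = 0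

/-- The partial trace `reduce S` as a linear map. -/
def reduceLinear (m : ι → Type*) [∀ i, Fintype (m i)] (S : Finset ι) :
    Matrix (∀ i, m i) (∀ i, m i) ℂ →ₗ[ℂ]
      Matrix (∀ i : {i // i ∈ S}, m i) (∀ i : {i // i ∈ S}, m i) ℂ where
  toFun := reduce S
  map_add' X Y := by ext; simp [reduce, Finset.sum_add_distrib]
  map_smul' r X := by ext; simp [reduce, Finset.mul_sum]

theorem IsSemicausal.isNonsignalling {S : Finset ι}
    {Φ : Matrix (∀ i, m i) (∀ i, m i) ℂ →ₗ[ℂ] Matrix (∀ i, n i) (∀ i, n i) ℂ}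
    (h : IsSemicausal Φ S) : IsNonsignalling Φ S := by
  obtain ⟨Γ, -, hΓ⟩ := h
  have hfactor : reduceLinear n S ∘ₗ Φ = Γ ∘ₗ reduceLinear m S := linearMap_ext_isState hΓ
  intro X hX
  calc reduce S (Φ X) = Γ (reduce S X) := LinearMap.congr_fun hfactor X
    _ = 0 := by rw [hX, map_zero]

/- Summing over all labels `u` counts every `z` outside `S` once for each label inside `S`. The
indices stay in `∀ i, m i`, so that cuts of `N` and of `N + 1` parties can be compared without
transport between subtypes. -/
theorem sum_piecewise_eq_card_mul_reduce (S : Finset ι) (X : Matrix (∀ i, m i) (∀ i, m i) ℂ)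
    (x y : ∀ i, m i) :
    ∑ u, X (S.piecewise x u) (S.piecewise y u) =
      Fintype.card (∀ i : {i // i ∈ S}, m i) * reduce S X (S.restrict x) (S.restrict y) := by
  have hpiecewise (x p) (z : ∀ i : {i // i ∉ S}, m i) :
      S.piecewise x ((Equiv.piEquivPiSubtypeProd (· ∈ S) m).symm (p, z)) =
        (Equiv.piEquivPiSubtypeProd (· ∈ S) m).symm (S.restrict x, z) := by
    funext i
    by_cases hi : i ∈ S <;> simp [hi]
  rw [← Equiv.sum_comp (Equiv.piEquivPiSubtypeProd (· ∈ S) m).symm, Fintype.sum_prod_type]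
  simp only [hpiecewise, Finset.sum_const, Finset.card_univ, nsmul_eq_mul, reduce, of_apply]

theorem reduce_eq_zero_iff [∀ i, Nonempty (m i)] {S : Finset ι}
    {X : Matrix (∀ i, m i) (∀ i, m i) ℂ} :
    reduce S X = 0 ↔ ∀ x y, ∑ u, X (S.piecewise x u) (S.piecewise y u) = 0 := by
  simp only [sum_piecewise_eq_card_mul_reduce]
  refine ⟨fun h x y => by simp [h], fun h => ?_⟩
  have hsurj : Function.Surjective (S.restrict : (∀ i, m i) → _) := fun p =>
    ⟨fun i => if hi : i ∈ S then p ⟨i, hi⟩ else Classical.arbitrary _, by ext i; simp⟩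
  ext p q
  obtain ⟨x, rfl⟩ := hsurj p
  obtain ⟨y, rfl⟩ := hsurj q
  exact (mul_eq_zero.mp (h x y)).resolve_left (Nat.cast_ne_zero.mpr Fintype.card_ne_zero)

theorem reduce_empty_eq_zero_iff [∀ i, Nonempty (m i)] {X : Matrix (∀ i, m i) (∀ i, m i) ℂ} :
    reduce ∅ X = 0 ↔ X.trace = 0 := by
  simp [reduce_eq_zero_iff, trace]

theorem reduce_univ_eq_zero_iff [∀ i, Nonempty (m i)] {X : Matrix (∀ i, m i) (∀ i, m i) ℂ} :
    reduce Finset.univ X = 0 ↔ X = 0 := by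
  rw [reduce_eq_zero_iff, ← Matrix.ext_iff]
  simp [Finset.prod_eq_zero_iff]

end Reduce

section LastParty

/-- The first `k` of `N` parties. -/
abbrev initialParties (N k : ℕ) : Finset (Fin N) :=
  Finset.univ.filter fun i => (i : ℕ) < k

variable {N : ℕ} {m n : Fin (N + 1) → Type*}

theorem piecewise_initialParties_snoc {k : ℕ} (hk : k ≤ N) (x p : ∀ i : Fin N, m i.castSucc)
    (y z : m (Fin.last N)) :
    (initialParties (N + 1) k).piecewise (Fin.snoc (α := m) x y) (Fin.snoc (α := m) p z) =
      Fin.snoc (α := m) ((initialParties N k).piecewise x p) z := by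
  funext i
  refine Fin.lastCases ?_ (fun i => ?_) i
  · simp [Finset.piecewise, hk]
  · simp [Finset.piecewise]

variable [∀ k, Fintype (m k)] [∀ k, Fintype (n k)]

theorem sum_pi_snoc {M : Type*} [AddCommMonoid M] (g : (∀ k, m k) → M) :
    ∑ u, g u = ∑ z : m (Fin.last N), ∑ p : ∀ k : Fin N, m k.castSucc,
      g (Fin.snoc (α := m) p z) := by
  rw [← (Fin.snocEquiv m).sum_comp, Fintype.sum_prod_type]
  rfl

/-- The partial trace over the last party. -/
def traceLast : Matrix (∀ k, m k) (∀ k, m k) ℂ →ₗ[ℂ]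
    Matrix (∀ k : Fin N, m k.castSucc) (∀ k : Fin N, m k.castSucc) ℂ where
  toFun X := of fun x y => ∑ z, X (Fin.snoc (α := m) x z) (Fin.snoc (α := m) y z)
  map_add' X Y := by ext; simp [Finset.sum_add_distrib]
  map_smul' c X := by ext; simp [Finset.mul_sum]

theorem traceLast_apply (X : Matrix (∀ k, m k) (∀ k, m k) ℂ) (x y) :
    traceLast X x y = ∑ z, X (Fin.snoc (α := m) x z) (Fin.snoc (α := m) y z) := rfl

theorem trace_traceLast (X : Matrix (∀ k, m k) (∀ k, m k) ℂ) : (traceLast X).trace = X.trace := by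
  simp only [trace, diag_apply, traceLast_apply, sum_pi_snoc]
  exact Finset.sum_comm

theorem IsDilation.traceLast_comp {c : Type*} [Fintype c]
    {Φ : Matrix (∀ k, m k) (∀ k, m k) ℂ →ₗ[ℂ] Matrix (∀ k, n k) (∀ k, n k) ℂ}
    {V : Matrix ((∀ k, n k) × c) (∀ k, m k) ℂ} (h : IsDilation Φ V) :
    IsDilation (traceLast ∘ₗ Φ) (V.submatrix
      (fun p : (∀ k : Fin N, n k.castSucc) × (n (Fin.last N) × c) =>
        (Fin.snoc (α := n) p.1 p.2.1, p.2.2)) id) := fun X => by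
  ext x y
  simp only [LinearMap.comp_apply, h X, traceLast_apply, traceAncilla, of_apply,
    Fintype.sum_prod_type]
  rfl

theorem reduce_initialParties_eq_zero_iff [∀ k, Nonempty (m k)] {k : ℕ} (hk : k ≤ N)
    {X : Matrix (∀ k, m k) (∀ k, m k) ℂ} :
    reduce (initialParties (N + 1) k) X = 0 ↔ reduce (initialParties N k) (traceLast X) = 0 := by
  have hsum (x y : ∀ i : Fin N, m i.castSucc) (s t : m (Fin.last N)) :
      ∑ u, X ((initialParties (N + 1) k).piecewise (Fin.snoc (α := m) x s) u)
        ((initialParties (N + 1) k).piecewise (Fin.snoc (α := m) y t) u) =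
      ∑ u, traceLast X ((initialParties N k).piecewise x u)
        ((initialParties N k).piecewise y u) := by
    simp only [sum_pi_snoc, piecewise_initialParties_snoc hk, traceLast_apply]
    exact Finset.sum_comm
  simp only [reduce_eq_zero_iff]
  refine ⟨fun h x y => ?_, fun h x y => ?_⟩
  · rw [← hsum x y (Classical.arbitrary _) (Classical.arbitrary _), h]
  · rw [← Fin.snoc_init_self x, ← Fin.snoc_init_self y, hsum, h]

theorem reduce_initialParties_eq_zero_iff_traceLast [∀ k, Nonempty (m k)]
    {X : Matrix (∀ k, m k) (∀ k, m k) ℂ} :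
    reduce (initialParties (N + 1) N) X = 0 ↔ traceLast X = 0 := by
  have huniv : initialParties N N = Finset.univ := by simp
  rw [reduce_initialParties_eq_zero_iff le_rfl, huniv, reduce_univ_eq_zero_iff]

variable [∀ k, DecidableEq (m k)]

/-- The isometry `|x⟩ ↦ |x⟩|x₀⟩` that adds a last party in the basis state `x₀`. -/
def prepareLast (x₀ : m (Fin.last N)) : Matrix (∀ k, m k) (∀ k : Fin N, m k.castSucc) ℂ :=
  (1 : Matrix (∀ k, m k) (∀ k, m k) ℂ).submatrix id fun x => Fin.snoc (α := m) x x₀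

theorem traceLast_conjMap_prepareLast (x₀ : m (Fin.last N))
    (X : Matrix (∀ k : Fin N, m k.castSucc) (∀ k : Fin N, m k.castSucc) ℂ) :
    traceLast (conjMap (prepareLast x₀) X) = X := by
  ext x y
  simp [traceLast_apply, conjMap_apply, Matrix.mul_apply, prepareLast, one_apply, Fin.snoc_inj,
    ite_and]

/-- The map seen by all parties but the last when the last one has the input `x₀`. -/
def dropLast (Φ : Matrix (∀ k, m k) (∀ k, m k) ℂ →ₗ[ℂ] Matrix (∀ k, n k) (∀ k, n k) ℂ)
    (x₀ : m (Fin.last N)) :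
    Matrix (∀ k : Fin N, m k.castSucc) (∀ k : Fin N, m k.castSucc) ℂ →ₗ[ℂ]
      Matrix (∀ k : Fin N, n k.castSucc) (∀ k : Fin N, n k.castSucc) ℂ :=
  traceLast ∘ₗ Φ ∘ₗ conjMap (prepareLast x₀)

variable {Φ : Matrix (∀ k, m k) (∀ k, m k) ℂ →ₗ[ℂ] Matrix (∀ k, n k) (∀ k, n k) ℂ}

theorem trace_dropLast (hΦ : ∀ X, (Φ X).trace = X.trace) (x₀ : m (Fin.last N))
    (X : Matrix (∀ k : Fin N, m k.castSucc) (∀ k : Fin N, m k.castSucc) ℂ) :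
    (dropLast Φ x₀ X).trace = X.trace := by
  rw [dropLast, LinearMap.comp_apply, LinearMap.comp_apply, trace_traceLast, hΦ,
    ← trace_traceLast, traceLast_conjMap_prepareLast]

section

variable [∀ k, Nonempty (m k)] [∀ k, Nonempty (n k)]

theorem IsNonsignalling.dropLast {k : ℕ} (hk : k ≤ N)
    (h : IsNonsignalling Φ (initialParties (N + 1) k)) (x₀ : m (Fin.last N)) :
    IsNonsignalling (dropLast Φ x₀) (initialParties N k) := by
  intro X hX
  refine (reduce_initialParties_eq_zero_iff hk).mp (h _ ?_)
  rwa [reduce_initialParties_eq_zero_iff hk, traceLast_conjMap_prepareLast]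

theorem dropLast_comp_traceLast
    (h : IsNonsignalling Φ (initialParties (N + 1) N)) (x₀ : m (Fin.last N)) :
    dropLast Φ x₀ ∘ₗ traceLast = traceLast ∘ₗ Φ := by
  refine LinearMap.ext fun X => sub_eq_zero.mp ?_
  change traceLast (Φ (conjMap (prepareLast x₀) (traceLast X))) - traceLast (Φ X) = 0
  rw [← map_sub, ← map_sub, ← reduce_initialParties_eq_zero_iff_traceLast]
  refine h _ (reduce_initialParties_eq_zero_iff_traceLast.mpr ?_)
  rw [map_sub, traceLast_conjMap_prepareLast, sub_self]

end

variable {b c : Type*} [Fintype c]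

/-- The operator `W ⊗ 1` which leaves the input of the last party untouched and counts it as a part
of the ancilla. -/
def idleLast (W : Matrix (b × c) (∀ k : Fin N, m k.castSucc) ℂ) :
    Matrix (b × (m (Fin.last N) × c)) (∀ k, m k) ℂ :=
  (W ⊗ₖ (1 : Matrix (m (Fin.last N)) (m (Fin.last N)) ℂ)).submatrix
    (fun p => ((p.1, p.2.2), p.2.1)) (fun u => (Fin.init u, u (Fin.last N)))

theorem IsDilation.comp_traceLast
    {Γ : Matrix (∀ k : Fin N, m k.castSucc) (∀ k : Fin N, m k.castSucc) ℂ →ₗ[ℂ] Matrix b b ℂ}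
    {W : Matrix (b × c) (∀ k : Fin N, m k.castSucc) ℂ} (h : IsDilation Γ W) :
    IsDilation (Γ ∘ₗ traceLast) (idleLast W) := by
  intro X
  let slice (z : m (Fin.last N)) :=
    X.submatrix (fun x => Fin.snoc (α := m) x z) fun x => Fin.snoc (α := m) x z
  have htrace : traceLast X = ∑ z, slice z := by
    ext x y
    simp only [traceLast_apply, slice, Matrix.sum_apply, submatrix_apply]
  have hslice (x y : b) (z f) : (idleLast W * X * (idleLast W)ᴴ) (x, (z, f))
      (y, (z, f)) = (W * slice z * Wᴴ) (x, f) (y, f) := by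
    simp only [Matrix.mul_apply, conjTranspose_apply, sum_pi_snoc, idleLast, submatrix_apply,
      slice, kroneckerMap_apply, one_apply, Fin.init_snoc, Fin.snoc_last, mul_ite, mul_one,
      mul_zero, ite_mul, zero_mul, apply_ite star, star_zero]
    rw [Finset.sum_comm]
    simp
  ext x y
  simp only [LinearMap.comp_apply, h _, htrace, Matrix.mul_sum, Matrix.sum_mul, traceAncilla,
    of_apply, Matrix.sum_apply, Fintype.sum_prod_type, hslice]
  exact Finset.sum_comm

end LastParty

section Sequential

/-- The operator `|φ⟩ ↦ |φ⟩|ψ⟩` that adds an ancilla in the state `ψ`. -/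
def attachKet (a : Type*) {d : Type*} [DecidableEq a] (ψ : EuclideanSpace ℂ d) :
    Matrix (a × d) a ℂ :=
  of fun p i => (1 : Matrix a a ℂ) p.1 i * ψ p.2

theorem attachKet_conj {a d : Type*} [Fintype a] [DecidableEq a] (ψ : EuclideanSpace ℂ d)
    (ρ : Matrix a a ℂ) : attachKet a ψ * ρ * (attachKet a ψ)ᴴ = ρ ⊗ₖ ketbra ψ := by
  ext ⟨i, f⟩ ⟨j, g⟩
  simp only [attachKet, one_apply, ite_mul, one_mul, zero_mul, Matrix.mul_apply, of_apply,
    Finset.sum_ite_eq, Finset.mem_univ, ↓reduceIte, conjTranspose_apply, apply_ite,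
    RCLike.star_def, star_zero, mul_zero, ketbra, kroneckerMap_apply, vecMulVec_apply]
  ring

theorem IsDilation.apply_eq_of_mul_attachKet {a b c d : Type*} [Fintype a] [DecidableEq a]
    [Fintype c] [Fintype d] {Φ : Matrix a a ℂ →ₗ[ℂ] Matrix b b ℂ} {S : Matrix (b × c) (a × d) ℂ}
    {ψ : EuclideanSpace ℂ d} (h : IsDilation Φ (S * attachKet a ψ)) (ρ : Matrix a a ℂ) :
    Φ ρ = traceAncilla (S * (ρ ⊗ₖ ketbra ψ) * Sᴴ) := by
  rw [h ρ, ← attachKet_conj, conjTranspose_mul]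
  simp only [Matrix.mul_assoc]

/-- The last of the factors of `sequentialOp (N + 1)`: the operator `Q` of the last party and the
ancilla, tensored with the identity on the outputs of the other parties. -/
def lastFactor {N : ℕ} {n : Fin (N + 1) → Type*} [∀ k, DecidableEq (n k)] {c d : Type*}
    (Q : Matrix (n (Fin.last N) × c) d ℂ) :
    Matrix ((∀ k, n k) × c) ((∀ k : Fin N, n k.castSucc) × d) ℂ :=
  ((1 : Matrix (∀ k : Fin N, n k.castSucc) (∀ k : Fin N, n k.castSucc) ℂ) ⊗ₖ Q).submatrix
    (fun p => (Fin.init p.1, (p.1 (Fin.last N), p.2))) id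

theorem sequentialOp_succ_mul_attachKet {N : ℕ} {m n : Fin (N + 1) → Type*}
    [∀ k, Fintype (m k)] [∀ k, DecidableEq (m k)] [∀ k, Fintype (n k)] [∀ k, DecidableEq (n k)]
    (e : ℕ → ℕ) (U : ∀ k : Fin (N + 1), Matrix (n k × Fin (e (k + 1))) (m k × Fin (e k)) ℂ)
    (ψ : EuclideanSpace ℂ (Fin (e 0))) :
    sequentialOp (N + 1) m n e U * attachKet (∀ k, m k) ψ =
      lastFactor (c := Fin (e (N + 1))) (d := m (Fin.last N) × Fin (e N)) (U (Fin.last N)) *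
        idleLast (sequentialOp N (fun k => m k.castSucc) (fun k => n k.castSucc) e
          (fun k => U k.castSucc) * attachKet (∀ k : Fin N, m k.castSucc) ψ) := by
  rw [sequentialOp, Matrix.mul_assoc]
  congr 1
  ext ⟨p, z, f⟩ u
  simp [Matrix.mul_apply, attachKet, idleLast, one_apply, Fintype.sum_prod_type]

/-- `Φ` is implemented by letting the parties interact one after the other, by unitaries, with an
ancilla of dimensions `e 0, e 1, …` that starts in a pure state. -/
def HasSequentialDilation {N : ℕ} {m n : Fin N → Type*}
    [∀ k, Fintype (m k)] [∀ k, DecidableEq (m k)] [∀ k, Fintype (n k)] [∀ k, DecidableEq (n k)]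
    (Φ : Matrix (∀ k, m k) (∀ k, m k) ℂ →ₗ[ℂ] Matrix (∀ k, n k) (∀ k, n k) ℂ) (e : ℕ → ℕ) : Prop :=
  ∃ (U : ∀ k : Fin N, Matrix (n k × Fin (e (k + 1))) (m k × Fin (e k)) ℂ)
    (ψ : EuclideanSpace ℂ (Fin (e 0))),
    (∀ k, IsUnitaryOp (U k)) ∧ ‖ψ‖ = 1 ∧
      IsDilation Φ (sequentialOp N m n e U * attachKet (∀ k, m k) ψ)

theorem hasSequentialDilation_zero {m n : Fin 0 → Type*}
    [∀ k, Fintype (m k)] [∀ k, DecidableEq (m k)] [∀ k, Fintype (n k)] [∀ k, DecidableEq (n k)]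
    {Φ : Matrix (∀ k, m k) (∀ k, m k) ℂ →ₗ[ℂ] Matrix (∀ k, n k) (∀ k, n k) ℂ} {e : ℕ → ℕ}
    (hΦ : ∀ X, (Φ X).trace = X.trace) (he : 0 < e 0) : HasSequentialDilation Φ e := by
  refine ⟨fun k => k.elim0, EuclideanSpace.single ⟨0, he⟩ 1, fun k => k.elim0, by simp,
    isDilation_iff.mpr fun i j x y => ?_⟩
  have htrace := hΦ (single i j 1)
  simp only [trace, diag_apply, Fintype.sum_unique] at htrace
  rw [Subsingleton.elim x default, Subsingleton.elim y default, htrace]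
  simp [Matrix.mul_apply, attachKet, sequentialOp, one_apply, Fintype.sum_prod_type,
    Subsingleton.elim i default, Subsingleton.elim j default]

variable {N : ℕ} {m n : Fin (N + 1) → Type*}
  [∀ k, Fintype (m k)] [∀ k, DecidableEq (m k)] [∀ k, Fintype (n k)] [∀ k, DecidableEq (n k)]
  {Φ : Matrix (∀ k, m k) (∀ k, m k) ℂ →ₗ[ℂ] Matrix (∀ k, n k) (∀ k, n k) ℂ}
  {Γ : Matrix (∀ k : Fin N, m k.castSucc) (∀ k : Fin N, m k.castSucc) ℂ →ₗ[ℂ]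
    Matrix (∀ k : Fin N, n k.castSucc) (∀ k : Fin N, n k.castSucc) ℂ}

theorem IsDilation.exists_lastFactor_mul_idleLast {c d : Type*} [Fintype c] [DecidableEq c]
    [Fintype d] [DecidableEq d] {V : Matrix ((∀ k, n k) × c) (∀ k, m k) ℂ}
    {W : Matrix ((∀ k : Fin N, n k.castSucc) × d) (∀ k : Fin N, m k.castSucc) ℂ}
    (hV : IsDilation Φ V) (hW : IsDilation Γ W) (hΓ : Γ ∘ₗ traceLast = traceLast ∘ₗ Φ)
    (hcard : Fintype.card (m (Fin.last N)) * Fintype.card d =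
      Fintype.card (n (Fin.last N)) * Fintype.card c) :
    ∃ Q : Matrix (n (Fin.last N) × c) (m (Fin.last N) × d) ℂ,
      IsUnitaryOp Q ∧ V = lastFactor Q * idleLast W := by
  have hW' := hW.comp_traceLast
  rw [hΓ] at hW'
  obtain ⟨Q, hQ, hmul⟩ := hW'.exists_isUnitaryOp hV.traceLast_comp (by simpa using hcard)
  refine ⟨Q, hQ, ?_⟩
  ext ⟨x, f⟩ u
  have hentry := congrFun₂ hmul (Fin.init x, (x (Fin.last N), f)) u
  rwa [submatrix_apply, Fin.snoc_init_self] at hentry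

theorem HasSequentialDilation.succ {e : ℕ → ℕ} (hΓ : HasSequentialDilation Γ e)
    {V : Matrix ((∀ k, n k) × Fin (e (N + 1))) (∀ k, m k) ℂ} (hV : IsDilation Φ V)
    (hdrop : Γ ∘ₗ traceLast = traceLast ∘ₗ Φ)
    (hcard : Fintype.card (m (Fin.last N)) * e N = Fintype.card (n (Fin.last N)) * e (N + 1)) :
    HasSequentialDilation Φ e := by
  obtain ⟨U, ψ, hU, hψ, hW⟩ := hΓ
  obtain ⟨Q, hQ, hVQ⟩ := hV.exists_lastFactor_mul_idleLast hW hdrop (by simpa using hcard)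
  let U' : ∀ k : Fin (N + 1), Matrix (n k × Fin (e (k + 1))) (m k × Fin (e k)) ℂ :=
    Fin.lastCases Q U
  have hlast : U' (Fin.last N) = Q := Fin.lastCases_last
  have hcast (k : Fin N) : U' k.castSucc = U k := Fin.lastCases_castSucc k
  refine ⟨U', ψ, Fin.forall_fin_succ'.mpr ⟨fun k => ?_, ?_⟩, hψ, ?_⟩
  · exact (hcast k).symm ▸ hU k
  · exact hlast.symm ▸ hQ
  · rw [sequentialOp_succ_mul_attachKet, hlast, funext hcast, ← hVQ]
    exact hV

end Sequential

theorem IsDilation.hasSequentialDilation : ∀ {N : ℕ} {m n : Fin N → Type*}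
    [∀ k, Fintype (m k)] [∀ k, DecidableEq (m k)] [∀ k, Nonempty (m k)]
    [∀ k, Fintype (n k)] [∀ k, DecidableEq (n k)] [∀ k, Nonempty (n k)]
    {Φ : Matrix (∀ k, m k) (∀ k, m k) ℂ →ₗ[ℂ] Matrix (∀ k, n k) (∀ k, n k) ℂ}
    {t : ℕ} {V : Matrix ((∀ k, n k) × Fin t) (∀ k, m k) ℂ} {e : ℕ → ℕ},
    IsDilation Φ V → (∀ X, (Φ X).trace = X.trace) →
    (∀ k < N, IsNonsignalling Φ (initialParties N k)) →
    (∀ k, Fintype.card (∀ k, n k) * t < e k) →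
    (∀ k : Fin N, Fintype.card (m k) * e k = Fintype.card (n k) * e (k + 1)) →
    HasSequentialDilation Φ e
  | 0, _, _, _, _, _, _, _, _, _, _, _, _, _, hΦ, _, he, _ =>
    hasSequentialDilation_zero hΦ ((Nat.zero_le _).trans_lt (he 0))
  | N + 1, m, n, _, _, _, _, _, _, Φ, t, V, e, hV, hΦ, hns, he, hcard => by
    let x₀ : m (Fin.last N) := Classical.arbitrary _
    obtain ⟨W, hW⟩ : ∃ W : Matrix ((∀ k : Fin N, n k.castSucc) ×
        Fin (Fintype.card (n (Fin.last N)) * t)) (∀ k : Fin N, m k.castSucc) ℂ,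
        IsDilation (dropLast Φ x₀) W :=
      (hV.traceLast_comp.comp_conjMap (prepareLast x₀)).exists_of_card_le (by simp)
    -- The dropped output joins the ancilla, so the bound on `e` survives the induction step.
    have hsize : Fintype.card (∀ k : Fin N, n k.castSucc) * (Fintype.card (n (Fin.last N)) * t) =
        Fintype.card (∀ k, n k) * t := by
      rw [Fintype.card_pi, Fintype.card_pi, Fin.prod_univ_castSucc, mul_assoc]
    have hdrop : HasSequentialDilation (dropLast Φ x₀) e := hW.hasSequentialDilation
      (trace_dropLast hΦ x₀) (fun k hk => (hns k (hk.trans N.lt_succ_self)).dropLast hk.le x₀)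
      (fun k => hsize.trans_lt (he k)) fun k => hcard k.castSucc
    obtain ⟨V', hV'⟩ : ∃ V' : Matrix ((∀ k, n k) × Fin (e (N + 1))) (∀ k, m k) ℂ,
        IsDilation Φ V' := hV.exists_of_card_le <| by
      simpa using (Nat.le_mul_of_pos_left t Fintype.card_pos).trans (he (N + 1)).le
    exact hdrop.succ hV' (dropLast_comp_traceLast (hns N N.lt_succ_self) x₀) (hcard (Fin.last N))

theorem exists_balanced_sequence {N : ℕ} {p q : Fin N → ℕ} (hp : ∀ i, 0 < p i)
    (hq : ∀ i, 0 < q i) (B : ℕ) :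
    ∃ e : ℕ → ℕ, (∀ k, B < e k) ∧ ∀ k : Fin N, p k * e k = q k * e (k + 1) := by
  let c (k : ℕ) (i : Fin N) : ℕ := if (i : ℕ) < k then p i else q i
  refine ⟨fun k => (B + 1) * ∏ i, c k i, fun k => ?_, fun k => ?_⟩
  · have hpos : 0 < ∏ i, c k i := Finset.prod_pos fun i _ => by
      simp only [c]
      split_ifs
      exacts [hp i, hq i]
    exact Nat.lt_of_succ_le (Nat.le_mul_of_pos_right _ hpos)
  · have hrest : ∏ i ∈ Finset.univ.erase k, c (k + 1) i = ∏ i ∈ Finset.univ.erase k, c k i :=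
      Finset.prod_congr rfl fun i hi => by
        have hik : (i : ℕ) ≠ k := Fin.val_ne_of_ne (Finset.ne_of_mem_erase hi)
        simp only [c, Nat.lt_succ_iff, hik.le_iff_lt]
    simp only [← Finset.mul_prod_erase _ _ (Finset.mem_univ k), hrest, c, lt_irrefl, if_false,
      Nat.lt_succ_self, if_true]
    ring

theorem IsOrderedSemicausal.isNonsignalling {N : ℕ} {m n : Fin N → Type*}
    [∀ k, Fintype (m k)] [∀ k, Nonempty (m k)] [∀ k, Fintype (n k)] [∀ k, Nonempty (n k)]
    {Φ : Matrix (∀ k, m k) (∀ k, m k) ℂ →ₗ[ℂ] Matrix (∀ k, n k) (∀ k, n k) ℂ}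
    (h : IsOrderedSemicausal Φ) (hΦ : ∀ X, (Φ X).trace = X.trace) {k : ℕ} (hk : k < N) :
    IsNonsignalling Φ (initialParties N k) := by
  rcases Nat.eq_zero_or_pos k with rfl | hpos
  · have hempty : initialParties N 0 = ∅ := by simp
    intro X hX
    rw [hempty, reduce_empty_eq_zero_iff] at hX ⊢
    rw [hΦ, hX]
  · exact (h k hpos hk).isNonsignalling

theorem nonempty_of_trace_preserving {a b : Type*} [Fintype a] [Fintype b] [Nonempty a]
    {Φ : Matrix a a ℂ → Matrix b b ℂ} (hΦ : ∀ X, (Φ X).trace = X.trace) : Nonempty b := by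
  classical
  by_contra hempty
  rw [not_nonempty_iff] at hempty
  have htrace := hΦ (single (Classical.arbitrary a) (Classical.arbitrary a) 1)
  simp [trace] at htrace

theorem mainTheorem9 {N : ℕ} (m n : Fin N → Type*)
    [∀ k, Fintype (m k)] [∀ k, DecidableEq (m k)] [∀ k, Nonempty (m k)]
    [∀ k, Fintype (n k)] [∀ k, DecidableEq (n k)]
    (Λ : Matrix (∀ k, m k) (∀ k, m k) ℂ →ₗ[ℂ] Matrix (∀ k, n k) (∀ k, n k) ℂ)
    (hΛ : IsChannel Λ) (hsc : IsOrderedSemicausal Λ) :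
    ∃ (e : ℕ → ℕ)
      (U : ∀ k : Fin N, Matrix (n k × Fin (e (k + 1))) (m k × Fin (e k)) ℂ)
      (ψ : EuclideanSpace ℂ (Fin (e 0))),
      (∀ k, IsUnitaryOp (U k)) ∧ ‖ψ‖ = 1 ∧
      ∀ ρ : Matrix (∀ k, m k) (∀ k, m k) ℂ,
        Λ ρ = traceAncilla (sequentialOp N m n e U * (ρ ⊗ₖ ketbra ψ) *
          (sequentialOp N m n e U).conjTranspose) := by
  have hn (k) : Nonempty (n k) := (nonempty_of_trace_preserving hΛ.2).map fun x => x k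
  obtain ⟨V, hV⟩ := hΛ.1.exists_isDilation
  obtain ⟨V', hV'⟩ := hV.exists_of_card_le (Fintype.card_fin _).ge
  obtain ⟨e, hlarge, hbalanced⟩ := exists_balanced_sequence
    (fun k => Fintype.card_pos (α := m k)) (fun k => Fintype.card_pos (α := n k)) _
  obtain ⟨U, ψ, hU, hψ, h⟩ :=
    hV'.hasSequentialDilation hΛ.2 (fun _ => hsc.isNonsignalling hΛ.2) hlarge hbalanced
  exact ⟨e, U, ψ, hU, hψ, h.apply_eq_of_mul_attachKet⟩
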